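/- **Setting.** Let $f:\mathbb R^{m_1}\times\cdots\times\mathbb R^{m_n}\to\mathbb R$ be differentiable and let $h_i:\mathbb R^{m_i}\to\mathbb R^{p_i}$ ($i=1,\dots,n$) be differentiable with convex components. Put $S_i=\{w: h_i(w)\le 0\}$, let $F(z)=f(z)+\sum_i\delta_{S_i}(x_i)$ for $z=(x_1,\dots,x_n)$, where $\delta_{S_i}$ is $0$ on $S_i$ and $+\infty$ elsewhere, and write $\nabla_i f$ for the gradient in the $i$-th block. $\|\cdot\|$ is the Euclidean norm. Fix $\bar\varepsilon>0$ and put $\bar S_i=\{w:\operatorname{dist}(w,S_i)\le\bar\varepsilon\}$, $\bar S=\prod_i\bar S_i$. **Assumptions.** 1. There are $L_i>0$ with $\|\nabla_i f(z_1)-\nabla_i f(z_2)\|\le L_i\|z_1-z_2\|$ for all $z_1,z_2\in\bar S$. Put $L=\max_i L_i$, fix $\gamma>1$, and let $M_l=\gamma L$, $M_u=M\ge M_l$. 2. Each $S_i$ is convex and compact; $h_i$ is affine or there is $\hat x_i$ with $h_i(\hat x_i)<0$ (componentwise); and there is $\tilde c_i\ge0$ with $\operatorname{dist}(w,S_i)\le\tilde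 c_i\|\max\{h_i(w),0\}\|$ for all $w$ with $\operatorname{dist}(w,\bar S_i)\le \sup_{z\in\bar S}\|\nabla_i f(z)\|/M_l$. 3. $F$ has the Łojasiewicz property at each of its stationary points: with $\partial F$ the Fréchet subdifferential, whenever $0\in\partial F(\bar x)$ there are $c,\eta>0$ and $\theta\in[0,1)$ with $|F(x)-F(\bar x)|^\theta\le c\,\operatorname{dist}(0,\partial F(x))$ whenever $\|x-\bar x\|\le\eta$, with the conventions $0^0=0$ and $\operatorname{dist}(0,\emptyset)=\infty$. 4. The tolerances satisfy $0\le\varepsilon^{(k)}\le\bar\varepsilon$ and $\sum_k\varepsilon^{(k)}<\infty$, and for some $\bar\theta\in(0,1)$, $\sum_k\big(\sum_{t\ge k}(\varepsilon^{(t)})^2\big)^{\bar\theta}<\infty$. **Iterates.** Let $\sigma_i^{(k)}\in[M_l,M_u]$ and let $z^{(k)}=(x_1^{(k)},\dots,x_n^{(k)})$, $k\ge0$, be generated by the infeasible inexact PALM method: for all $k\ge0$ and $i$, with $g_i^{(k)}=\nabla_i f(x_{<i}^{(k+1)},x_{\ge i}^{(k)})$ and $\tilde x_i^{(k)}=x_i^{(k)}-g_i^{(k)}/\sigma_i^{(k)}$,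 there is $\lambda\in\mathbb R_+^{p_i}$ with $\sqrt{r_i(x_i^{(k+1)},\lambda,\tilde x_i^{(k)})}\le\varepsilon^{(k)}$, where $$r_i(x,\lambda,\tilde x)=\max\{\langle x,s\rangle,0\}+\|s\|_\infty+\|\max\{h_i(x),0\}\|_\infty+\max\{-\langle\lambda,h_i(x)\rangle,0\},\qquad s=x-\tilde x+\nabla h_i(x)\lambda .$$ (Here $\nabla h_i(x)\lambda=\sum_j\lambda_j\nabla h_{i,j}(x)$.) Let $\bar z^{(k+1)}$ be the point whose $i$-th block is the minimizer over $x\in S_i$ of $\langle g_i^{(k)},x-x_i^{(k)}\rangle+\frac{\sigma_i^{(k)}}2\|x-x_i^{(k)}\|^2$, and let $\bar z^{(0)}\in\prod_iS_i$ be arbitrary. **Surrogate.** With $\nu=12/(\gamma-1)$, put $$C_1^{(k)}=\tfrac12\Big(\max_i\sigma_i^{(k)}+L\big[\tfrac\nu2n^2+(2+\tfrac2\nu-\tfrac\nu2)n+2\nu+\tfrac4\nu+3\big]\Big),\quad u^{(k)}=\sum_{t\ge k}C_1^{(t)}\|\bar z^{(t)}-z^{(t)}\|^2,\quad v^{(k)}=F(\bar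 z^{(k)})+u^{(k)}+u^{(k+1)} .$$ **Theorem.** Let $K\in\mathbb N$ be such that $z^{(k)}\in\bar S$ for all $k\ge K$. Then the series defining $u^{(k)}$ converge and $v^{(k)}$ converges to some $\bar F\in\mathbb R$. If $v^{(K)}=\bar F$, then $z^{(k)}$ converges to some $\bar z$, and: (i) if $\varepsilon^{(k)}=\bar\varepsilon\tilde\rho^k$ for all $k\ge0$ with $\tilde\rho\in(0,1)$, then there is a constant $C$ with $\|z^{(k)}-\bar z\|\le C\tilde\rho^k$ for all $k\ge K$; (ii) if $\varepsilon^{(k)}=\bar\varepsilon/(k+1)^\ell$ for all $k\ge0$ with $\ell>1$, then there is a constant $C$ with $\|z^{(k)}-\bar z\|\le Ck^{-(\ell-1)}$ for all $k\ge K$ with $k\ge1$. -/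

import Mathlib

open Filter Topology

noncomputable section

/-- The Fréchet subdifferential of `G : E → (-∞, ∞]` at `x`; it is empty outside `dom G`. -/
def frechetSubdiff {E : Type*} [NormedAddCommGroup E] [InnerProductSpace ℝ E]
    (G : E → EReal) (x : E) : Set E :=
  {u | G x < ⊤ ∧
    0 ≤ Filter.liminf
      (fun y => (G y - G x - ((inner ℝ u (y - x) : ℝ) : EReal)) / ((‖y - x‖ : ℝ) : EReal))
      (𝓝[≠] x)}

/-- `x` is a stationary point of `G`. -/
def IsStationaryPt {E : Type*} [NormedAddCommGroup E] [InnerProductSpace ℝ E]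
    (G : E → EReal) (x : E) : Prop :=
  0 ∈ frechetSubdiff G x

/-- The power `a ^ θ` with the convention `0 ^ 0 = 0`. -/
def lojPow (a θ : ℝ) : ℝ := if a = 0 then 0 else a ^ θ

/-- The Łojasiewicz property of `G` at `xbar`. The distance is `∞` where the subdifferential is
empty, so the inequality only says something at points of the domain of `G`. -/
def HasLojasiewicz {E : Type*} [NormedAddCommGroup E] [InnerProductSpace ℝ E]
    (G : E → EReal) (xbar : E) : Prop :=
  ∃ c θ η : ℝ, 0 < c ∧ 0 ≤ θ ∧ θ < 1 ∧ 0 < η ∧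
    ∀ x ∈ Metric.closedBall xbar η,
      ENNReal.ofReal (lojPow |(G x).toReal - (G xbar).toReal| θ) ≤
        ENNReal.ofReal c * Metric.infEDist 0 (frechetSubdiff G x)

/-- The block-structured problem `min f(x₁, …, xₙ)` subject to `hᵢ(xᵢ) ≤ 0` for all `i`, with `f`
differentiable and `hᵢ` convex and differentiable. -/
structure BlockProblem (n : ℕ) where
  m : Fin n → ℕ
  p : Fin n → ℕ
  f : PiLp 2 (fun i => EuclideanSpace ℝ (Fin (m i))) → ℝ
  h : (i : Fin n) → EuclideanSpace ℝ (Fin (m i)) → EuclideanSpace ℝ (Fin (p i))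
  differentiable_f : Differentiable ℝ f
  convex_h : ∀ i j, ConvexOn ℝ Set.univ (fun x => h i x j)
  differentiable_h : ∀ i, Differentiable ℝ (h i)

namespace BlockProblem

variable {n : ℕ} (P : BlockProblem n)

/-- The space of the `i`-th block. -/
abbrev Block (i : Fin n) : Type := EuclideanSpace ℝ (Fin (P.m i))

/-- The Euclidean product of all the blocks. -/
abbrev Space : Type := PiLp 2 (fun i => P.Block i)

/-- The feasible set `Sᵢ = {w | hᵢ(w) ≤ 0}`. -/
def S (i : Fin n) : Set (P.Block i) := {w | ∀ j, P.h i w j ≤ 0}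

open Classical in
/-- The extended-valued objective `F = f + ∑ᵢ δ_{Sᵢ}`. -/
def F (z : P.Space) : EReal :=
  (P.f z : EReal) + ∑ i, (if z i ∈ P.S i then (0 : EReal) else ⊤)

/-- The enlarged set `S̄ᵢ = {w | dist(w, Sᵢ) ≤ ε̄}`. -/
def Sbar (εbar : ℝ) (i : Fin n) : Set (P.Block i) :=
  {w | Metric.infDist w (P.S i) ≤ εbar}

/-- The product of the sets `S̄ᵢ`. -/
def SbarProd (εbar : ℝ) : Set P.Space := {z | ∀ i, z i ∈ P.Sbar εbar i}

/-- The block gradient `∇ᵢ f(z)`. -/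
def blockGrad (i : Fin n) (z : P.Space) : P.Block i := gradient P.f z i

/-- `∇ᵢ f` is Lipschitz with modulus `L i > 0` over the product of the `S̄ᵢ`, for every `i`. -/
def BlockLipschitz (εbar : ℝ) (L : Fin n → ℝ) : Prop :=
  ∀ i, 0 < L i ∧ ∀ z₁ ∈ P.SbarProd εbar, ∀ z₂ ∈ P.SbarProd εbar,
    ‖P.blockGrad i z₁ - P.blockGrad i z₂‖ ≤ L i * ‖z₁ - z₂‖

/-- `sup ‖∇ᵢ f(z)‖` over the product of the `S̄ᵢ`. -/
def gradSup (εbar : ℝ) (i : Fin n) : ℝ :=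
  sSup ((fun z => ‖P.blockGrad i z‖) '' P.SbarProd εbar)

/-- The set `S̃ᵢ` of the points at distance at most `(sup ‖∇ᵢ f‖) / M_l` from `S̄ᵢ`. -/
def Stilde (εbar Ml : ℝ) (i : Fin n) : Set (P.Block i) :=
  {w | Metric.infDist w (P.Sbar εbar i) ≤ P.gradSup εbar i / Ml}

/-- The Hoffman-like error bound for `hᵢ` over `S̃ᵢ`. -/
def HoffmanBound (εbar Ml : ℝ) (i : Fin n) : Prop :=
  ∃ c : ℝ, 0 ≤ c ∧ ∀ w ∈ P.Stilde εbar Ml i,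
    Metric.infDist w (P.S i) ≤
      c * ‖(WithLp.toLp 2 (fun j => max (P.h i w j) 0) : EuclideanSpace ℝ (Fin (P.p i)))‖

/-- The assumption on the constraints: each `Sᵢ` is convex and compact, `hᵢ` is affine or satisfies
the Slater condition, and the Hoffman-like error bound holds. -/
def ConstraintAssumption (εbar Ml : ℝ) : Prop :=
  ∀ i, Convex ℝ (P.S i) ∧ IsCompact (P.S i) ∧
    ((∃ A : P.Block i →ᵃ[ℝ] EuclideanSpace ℝ (Fin (P.p i)), ∀ x, P.h i x = A x) ∨
      (∃ xhat : P.Block i, ∀ j, P.h i xhat j < 0)) ∧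
    P.HoffmanBound εbar Ml i

/-- The point whose blocks are those of `a` before `i` and those of `b` from `i` on. -/
def mix (i : Fin n) (a b : P.Space) : P.Space :=
  WithLp.toLp 2 (fun j => if j < i then a j else b j)

/-- The gradient `∇ᵢ f(x_{<i}^{(k+1)}, x_{≥i}^{(k)})`. -/
def stepGrad (z : ℕ → P.Space) (k : ℕ) (i : Fin n) : P.Block i :=
  P.blockGrad i (P.mix i (z (k + 1)) (z k))

/-- The point `x̃ᵢ^{(k)}` to be projected onto `Sᵢ`. -/
def xtilde (σ : ℕ → Fin n → ℝ) (z : ℕ → P.Space) (k : ℕ) (i : Fin n) : P.Block i :=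
  z k i - (1 / σ k i) • P.stepGrad z k i

/-- The vector `x - x̃ + ∇hᵢ(x) lam`. -/
def dualResidual (i : Fin n) (x : P.Block i) (lam : Fin (P.p i) → ℝ) (xt : P.Block i) :
    P.Block i :=
  x - xt + ∑ j, lam j • gradient (fun y => P.h i y j) x

/-- The residual function `rᵢ(x, lam, x̃)`. The norms of functions on `Fin _` are maximum norms. -/
def residual (i : Fin n) (x : P.Block i) (lam : Fin (P.p i) → ℝ) (xt : P.Block i) : ℝ :=
  max (inner ℝ x (P.dualResidual i x lam xt)) 0
    + ‖(WithLp.ofLp (P.dualResidual i x lam xt) : Fin (P.m i) → ℝ)‖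
    + ‖(fun j => max (P.h i x j) 0 : Fin (P.p i) → ℝ)‖
    + max (-∑ j, lam j * P.h i x j) 0

/-- `z` is a sequence of iterates of the infeasible inexact PALM method with tolerances `ε ≤ ε̄` and
proximal parameters `σ` in `[Ml, Mu]`. -/
structure IsIterates (εbar Ml Mu : ℝ) (ε : ℕ → ℝ) (σ : ℕ → Fin n → ℝ) (z : ℕ → P.Space) :
    Prop where
  tol_nonneg : ∀ k, 0 ≤ ε k
  tol_le : ∀ k, ε k ≤ εbar
  prox_mem : ∀ k i, σ k i ∈ Set.Icc Ml Mu
  inexact : ∀ k i, ∃ lam : Fin (P.p i) → ℝ, (∀ j, 0 ≤ lam j) ∧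
    Real.sqrt (P.residual i (z (k + 1) i) lam (P.xtilde σ z k i)) ≤ ε k

/-- The objective of the `i`-th proximal linearized subproblem. -/
def proxObj (σ : ℕ → Fin n → ℝ) (z : ℕ → P.Space) (k : ℕ) (i : Fin n) (x : P.Block i) : ℝ :=
  inner ℝ (P.stepGrad z k i) (x - z k i) + σ k i / 2 * ‖x - z k i‖ ^ 2

/-- `zbar (k + 1) i` is the exact solution over `Sᵢ` of the `i`-th subproblem of step `k`; the
starting point `zbar 0`, which solves no subproblem, is any feasible point. -/
structure IsExactIterates (σ : ℕ → Fin n → ℝ) (z zbar : ℕ → P.Space) : Prop where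
  init_mem : ∀ i, zbar 0 i ∈ P.S i
  mem : ∀ k i, zbar (k + 1) i ∈ P.S i
  isMinOn : ∀ k i, IsMinOn (P.proxObj σ z k i) (P.S i) (zbar (k + 1) i)

/-- The constant `C₁^{(k)}`, with `L` the maximal block modulus and `ν = 12 / (γ - 1)`. -/
def C1 {n : ℕ} (L γ : ℝ) (σ : ℕ → Fin n → ℝ) (k : ℕ) : ℝ :=
  let ν : ℝ := 12 / (γ - 1)
  ((⨆ i, σ k i) + L * (ν / 2 * (n : ℝ) ^ 2 + (2 + 2 / ν - ν / 2) * (n : ℝ)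
    + 2 * ν + 4 / ν + 3)) / 2

/-- The summand `C₁^{(t)} ‖z̄^{(t)} - z^{(t)}‖²` of the error tails. -/
def errTerm (L γ : ℝ) (σ : ℕ → Fin n → ℝ) (z zbar : ℕ → P.Space) (t : ℕ) : ℝ :=
  C1 L γ σ t * ‖zbar t - z t‖ ^ 2

/-- The error tail `u^{(k)} = ∑_{t ≥ k} C₁^{(t)} ‖z̄^{(t)} - z^{(t)}‖²`. -/
def errTail (L γ : ℝ) (σ : ℕ → Fin n → ℝ) (z zbar : ℕ → P.Space) (k : ℕ) : ℝ :=
  ∑' t : ℕ, P.errTerm L γ σ z zbar (k + t)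

/-- The surrogate `v^{(k)} = F(z̄^{(k)}) + u^{(k)} + u^{(k+1)}`; the value of `F` is real here because
`z̄^{(k)}` is feasible. -/
def surrogate (L γ : ℝ) (σ : ℕ → Fin n → ℝ) (z zbar : ℕ → P.Space) (k : ℕ) : ℝ :=
  (P.F (zbar k)).toReal + P.errTail L γ σ z zbar k + P.errTail L γ σ z zbar (k + 1)

end BlockProblem

/-- The tolerances are nonnegative and summable, and for some `θbar ∈ (0, 1)` the powers
`(∑_{t ≥ k} ε_t²) ^ θbar` are summable over `k`. -/
def ToleranceCondition (ε : ℕ → ℝ) : Prop :=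
  (∀ k, 0 ≤ ε k) ∧ Summable ε ∧
    ∃ θbar : ℝ, 0 < θbar ∧ θbar < 1 ∧ Summable (fun k : ℕ => (∑' t : ℕ, ε (k + t) ^ 2) ^ θbar)

end

noncomputable section
-- The surrogate is a Lyapunov function. Between consecutive exact points, `f` drops by `L(γ-1)/4`
-- times `‖z̄^(k+1) - z̄^(k)‖²`, up to multiples of the squared errors `‖z̄ - z‖²` at `k` and `k+1`,
-- which appear because each subproblem is built at inexact points (`f_exact_succ_add_le`). The
-- constant `C1` dominates both coefficients (`le_C1`), and the tails `u` pay for the errors, so `v`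
-- decreases from `K` on; compactness of the feasible set bounds it below. If `v^(K)` already equals
-- the limit, every later drop vanishes and `z̄` is constant from `K` on.
--
-- It remains to compare `z^(k+1)` with `z̄^(k+1)`. A small residual makes each block an approximate
-- solution of the variational inequality of a projection, and the Hoffman bound puts it near `Sᵢ`;
-- together they give an error of order `ε^(k)` (`exists_norm_sub_le`). Hence `z` converges at the
-- rate of the tolerances.
-- Convexity, proximal minimizers and descent
/-- A convex differentiable function lies above its tangent plane. -/
theorem ConvexOn.add_inner_gradient_le {E : Type*} [NormedAddCommGroup E] [InnerProductSpace ℝ E]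
    [CompleteSpace E] {φ : E → ℝ} (hφ : ConvexOn ℝ Set.univ φ) {x : E}
    (hd : DifferentiableAt ℝ φ x) (y : E) :
    φ x + inner ℝ (gradient φ x) (y - x) ≤ φ y := by
  have hc : ConvexOn ℝ Set.univ (fun t : ℝ => φ (AffineMap.lineMap x y t)) := by
    exact hφ.comp_affineMap (AffineMap.lineMap x y : ℝ →ᵃ[ℝ] E)
  have hl : HasDerivAt (fun t : ℝ => AffineMap.lineMap x y t) (y - x) (0 : ℝ) :=
    AffineMap.hasDerivAt_lineMap
  have hg : HasFDerivAt φ (InnerProductSpace.toDual ℝ E (gradient φ x))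
      (AffineMap.lineMap x y (0 : ℝ)) := by
    simpa using hd.hasGradientAt.hasFDerivAt
  have hder := hg.comp_hasDerivAt (0 : ℝ) hl
  have := hc.le_slope_of_hasDerivAt (Set.mem_univ (0 : ℝ)) (Set.mem_univ (1 : ℝ)) one_pos hder
  simp [slope_def_field] at this ⊢
  linarith

/-- A first-order condition from a quadratic inequality near `0`. -/
theorem nonneg_of_forall_mul_add_mul_sq_nonneg {a b : ℝ}
    (h : ∀ t : ℝ, 0 < t → t ≤ 1 → 0 ≤ t * a + t ^ 2 * b) : 0 ≤ a := by
  have hlim : Tendsto (fun t : ℝ => a + t * b) (𝓝[>] 0) (𝓝 a) := by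
    have : Tendsto (fun t : ℝ => a + t * b) (𝓝 0) (𝓝 (a + 0 * b)) :=
      (continuous_const.add (continuous_id.mul continuous_const)).tendsto 0
    simpa using this.mono_left nhdsWithin_le_nhds
  refine ge_of_tendsto hlim ?_
  filter_upwards [Ioc_mem_nhdsGT (zero_lt_one' ℝ)] with t ht
  have := h t ht.1 ht.2
  have h2 : t * a + t ^ 2 * b = t * (a + t * b) := by ring
  rw [h2] at this
  exact nonneg_of_mul_nonneg_right this ht.1

/-- The variational inequality for the minimizer of a proximal linearized objective. -/
theorem IsMinOn.inner_prox_nonneg {E : Type*} [NormedAddCommGroup E] [InnerProductSpace ℝ E]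
    {s : Set E} (hs : Convex ℝ s) {g x p w : E} {σ : ℝ}
    (hmin : IsMinOn (fun y => inner ℝ g (y - x) + σ / 2 * ‖y - x‖ ^ 2) s p)
    (hp : p ∈ s) (hw : w ∈ s) : 0 ≤ inner ℝ (g + σ • (p - x)) (w - p) := by
  -- Minimality is tested at `p + t(w - p)`; the desired inner product is the coefficient of `t`.
  refine nonneg_of_forall_mul_add_mul_sq_nonneg (b := σ / 2 * ‖w - p‖ ^ 2) fun t ht0 ht1 => ?_
  have hmem : p + t • (w - p) ∈ s := hs.add_smul_sub_mem hp hw ⟨ht0.le, ht1⟩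
  have h := isMinOn_iff.1 hmin _ hmem
  have e : p + t • (w - p) - x = (p - x) + t • (w - p) := by abel
  simp only [e, inner_add_right, inner_add_left, real_inner_smul_right, real_inner_smul_left,
    norm_add_sq_real, norm_smul, mul_pow, Real.norm_eq_abs, sq_abs] at h ⊢
  nlinarith

/-- The three-point inequality for the minimizer of a proximal linearized objective. -/
theorem IsMinOn.inner_prox_le {E : Type*} [NormedAddCommGroup E] [InnerProductSpace ℝ E]
    {s : Set E} (hs : Convex ℝ s) {g x p w : E} {σ : ℝ}
    (hmin : IsMinOn (fun y => inner ℝ g (y - x) + σ / 2 * ‖y - x‖ ^ 2) s p)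
    (hp : p ∈ s) (hw : w ∈ s) :
    inner ℝ g (p - w) ≤ σ / 2 * (‖w - x‖ ^ 2 - ‖p - x‖ ^ 2 - ‖p - w‖ ^ 2) := by
  have h := hmin.inner_prox_nonneg hs hp hw
  have e : w - x = (p - x) + (w - p) := by abel
  rw [e, norm_add_sq_real, ← norm_neg (p - w), neg_sub, ← neg_sub w p, inner_neg_right]
  rw [inner_add_left, real_inner_smul_left] at h
  linarith

/-- The descent lemma along a segment. -/
theorem sub_le_of_gradient_lipschitz_segment {E : Type*} [NormedAddCommGroup E]
    [InnerProductSpace ℝ E] [CompleteSpace E] {φ : E → ℝ} (hφ : Differentiable ℝ φ) {x d : E}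
    {q : ℝ} (h : ∀ t ∈ Set.Icc (0 : ℝ) 1,
      inner ℝ (gradient φ (x + t • d) - gradient φ x) d ≤ t * q) :
    φ (x + d) - φ x ≤ inner ℝ (gradient φ x) d + q / 2 := by
  -- Subtracting the linear term and `t²q/2` makes the derivative nonpositive on `[0, 1]`.
  have hder : ∀ t : ℝ, HasDerivAt
      (fun t : ℝ => φ (x + t • d) - t * inner ℝ (gradient φ x) d - t ^ 2 * (q / 2))
      (inner ℝ (gradient φ (x + t • d)) d - inner ℝ (gradient φ x) d - t * q) t := by
    intro t
    have hl : HasDerivAt (fun t : ℝ => x + t • d) d t := by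
      simpa using ((hasDerivAt_id t).smul_const d).const_add x
    have h1 := (hφ (x + t • d)).hasGradientAt.hasFDerivAt.comp_hasDerivAt t hl
    have h2 := (h1.sub ((hasDerivAt_id t).mul_const (inner ℝ (gradient φ x) d))).sub
      (((hasDerivAt_id t).pow 2).mul_const (q / 2))
    refine h2.congr_deriv ?_
    simp
    ring
  have hanti : AntitoneOn
      (fun t : ℝ => φ (x + t • d) - t * inner ℝ (gradient φ x) d - t ^ 2 * (q / 2))
      (Set.Icc 0 1) := by
    refine antitoneOn_of_deriv_nonpos (convex_Icc 0 1)
      (fun t _ => (hder t).continuousAt.continuousWithinAt)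
      (fun t _ => (hder t).differentiableAt.differentiableWithinAt) fun t ht => ?_
    rw [(hder t).deriv]
    have := h t (interior_subset ht)
    rw [inner_sub_left] at this
    linarith
  have := hanti (Set.left_mem_Icc.2 zero_le_one) (Set.right_mem_Icc.2 zero_le_one) zero_le_one
  simp at this ⊢
  linarith

/-! ### Approximate projections and shifted bounds -/

theorem EuclideanSpace.norm_le_sqrt_mul_norm_ofLp {d : ℕ} (x : EuclideanSpace ℝ (Fin d)) :
    ‖x‖ ≤ √d * ‖(WithLp.ofLp x : Fin d → ℝ)‖ := by
  rw [EuclideanSpace.norm_eq]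
  refine Real.sqrt_le_iff.2 ⟨by positivity, ?_⟩
  rw [mul_pow, Real.sq_sqrt (by positivity)]
  calc ∑ i, ‖x i‖ ^ 2 ≤ ∑ _i : Fin d, ‖(WithLp.ofLp x : Fin d → ℝ)‖ ^ 2 := by
        gcongr with i
        exact norm_le_pi_norm (WithLp.ofLp x) i
    _ = _ := by simp

/-- The error estimate for an approximate projection: `x` is nearly a solution of the variational
inequality on `s` and close to `s`, and `p` is the exact projection of `xt`. -/
theorem sq_norm_sub_le_of_approx_projection {E : Type*} [NormedAddCommGroup E]
    [InnerProductSpace ℝ E] {x xt p y : E} {a b : ℝ}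
    (h1 : -a ≤ inner ℝ (x - xt) (p - x)) (h2 : 0 ≤ inner ℝ (p - xt) (y - p))
    (h3 : ‖y - x‖ ≤ b) : ‖x - p‖ ^ 2 ≤ a + ‖p - xt‖ * b := by
  have h4 : inner ℝ (p - xt) (y - x) ≤ ‖p - xt‖ * b :=
    (real_inner_le_norm _ _).trans (by gcongr)
  -- After these splittings the cross term `⟨p - xt, x - p⟩` cancels when `h1` and `h2` are added.
  have e1 : y - p = (y - x) + (x - p) := by abel
  have e2 : x - xt = (x - p) + (p - xt) := by abel
  rw [e1, inner_add_right] at h2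
  rw [e2, inner_add_left, ← neg_sub x p, inner_neg_right, inner_neg_right,
    real_inner_self_eq_norm_sq] at h1
  linarith

/-- The tolerance at step `k` controls the iterate `k + 1`, so index `K` itself is not covered;
positivity of `b K` lets the constant absorb it. -/
theorem exists_forall_ge_le_mul_of_succ {a b : ℕ → ℝ} {K : ℕ} {A : ℝ} (hbK : 0 < b K)
    (hb : ∀ k, 0 ≤ b k) (h : ∀ k ≥ K, a (k + 1) ≤ A * b (k + 1)) :
    ∃ C : ℝ, ∀ k ≥ K, a k ≤ C * b k := by
  refine ⟨max A (a K / b K), fun k hk => ?_⟩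
  rcases hk.eq_or_lt with rfl | hlt
  · rw [← div_le_iff₀ hbK]
    exact le_max_right _ _
  · obtain ⟨m, rfl⟩ : ∃ m, k = m + 1 := ⟨k - 1, by omega⟩
    exact (h m (by omega)).trans (mul_le_mul_of_nonneg_right (le_max_left _ _) (hb _))

/-! ### Splicing blocks of two points -/

namespace BlockProblem
variable {n : ℕ} {P : BlockProblem n}

theorem toReal_F_of_mem {x : P.Space} (hx : ∀ i, x i ∈ P.S i) : (P.F x).toReal = P.f x := by
  simp [F, hx]

/-- The point whose first `m` blocks are those of `a` and whose other blocks are those of `b`. -/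
def splice (m : ℕ) (a b : P.Space) : P.Space :=
  WithLp.toLp 2 (fun j => if (j : ℕ) < m then a j else b j)

/-- Indexing by `ℕ` instead of `Fin n` also allows `m = n`, the last point of the telescoping sum
over blocks. -/
theorem mix_eq_splice (i : Fin n) (a b : P.Space) : P.mix i a b = splice (i : ℕ) a b := by
  rfl

theorem splice_zero (a b : P.Space) : splice 0 a b = b := by
  ext1 j
  simp [splice]

theorem splice_full (a b : P.Space) : splice n a b = a := by
  ext1 j
  simp [splice]

theorem splice_mem {s : (i : Fin n) → Set (P.Block i)} {a b : P.Space} (ha : ∀ i, a i ∈ s i)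
    (hb : ∀ i, b i ∈ s i) (m : ℕ) (i : Fin n) : splice m a b i ∈ s i := by
  simp only [splice]
  split_ifs
  exacts [ha i, hb i]

theorem splice_succ (i : Fin n) (a b : P.Space) :
    splice ((i : ℕ) + 1) a b
      = splice (i : ℕ) a b + WithLp.toLp 2 (Pi.single i (a i - b i)) := by
  ext1 j
  rcases lt_trichotomy i j with h | rfl | h
  · have h1 : ¬ (j : ℕ) < i + 1 := by rw [Fin.lt_def] at h; omega
    have h2 : ¬ (j : ℕ) < i := by rw [Fin.lt_def] at h; omega
    simp only [splice, PiLp.add_apply, h1, h2, if_false, Pi.single_eq_of_ne h.ne', add_zero]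
  · simp [splice]
  · have h1 : (j : ℕ) < i + 1 := by rw [Fin.lt_def] at h; omega
    have h2 : (j : ℕ) < i := h
    simp only [splice, PiLp.add_apply, h1, h2, if_true, Pi.single_eq_of_ne h.ne, add_zero]

theorem inner_single (x : P.Space) (i : Fin n) (d : P.Block i) :
    inner ℝ x (WithLp.toLp 2 (Pi.single i d) : P.Space) = inner ℝ (x i) d := by
  rw [PiLp.inner_apply, Finset.sum_eq_single i]
  · simp
  · intro j _ hj
    simp [hj]
  · simp

theorem norm_sq_eq_sum (x : P.Space) : ‖x‖ ^ 2 = ∑ i, ‖x i‖ ^ 2 :=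
  PiLp.norm_sq_eq_of_L2 _ x

theorem norm_sq_single (i : Fin n) (d : P.Block i) :
    ‖(WithLp.toLp 2 (Pi.single i d) : P.Space)‖ ^ 2 = ‖d‖ ^ 2 := by
  rw [← real_inner_self_eq_norm_sq, inner_single]
  simp

theorem norm_splice_sub_splice_sq_le (m : ℕ) (a b a' b' : P.Space) :
    ‖splice m a b - splice m a' b'‖ ^ 2 ≤ ‖a - a'‖ ^ 2 + ‖b - b'‖ ^ 2 := by
  simp only [norm_sq_eq_sum, ← Finset.sum_add_distrib]
  refine Finset.sum_le_sum fun j _ => ?_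
  simp only [splice, PiLp.sub_apply]
  split_ifs
  · exact le_add_of_nonneg_right (by positivity)
  · exact le_add_of_nonneg_left (by positivity)

theorem mem_Sbar_of_mem_S {εbar : ℝ} (hε : 0 ≤ εbar) {i : Fin n} {x : P.Block i}
    (hx : x ∈ P.S i) : x ∈ P.Sbar εbar i := by
  simpa [Sbar, Metric.infDist_zero_of_mem hx] using hε

/-! ### Sufficient decrease between exact iterates -/

/-- The descent inequality in a single block. -/
theorem f_splice_succ_le {εbar : ℝ} {Lmod : Fin n → ℝ} (hε : 0 ≤ εbar)
    (hLip : P.BlockLipschitz εbar Lmod) (hconv : ∀ i, Convex ℝ (P.S i)) {a b : P.Space}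
    (ha : ∀ i, a i ∈ P.S i) (hb : ∀ i, b i ∈ P.S i) (i : Fin n) :
    P.f (splice ((i : ℕ) + 1) a b) - P.f (splice (i : ℕ) a b) ≤
      inner ℝ (P.blockGrad i (splice (i : ℕ) a b)) (a i - b i)
        + Lmod i * ‖a i - b i‖ ^ 2 / 2 := by
  rw [splice_succ]
  set D : P.Space := WithLp.toLp 2 (Pi.single i (a i - b i)) with hD
  have hin : ∀ x : P.Space, inner ℝ x D = inner ℝ (x i) (a i - b i) := fun x => inner_single x i _
  have hDn : ‖D‖ = ‖a i - b i‖ :=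
    (pow_left_inj₀ (norm_nonneg _) (norm_nonneg _) two_ne_zero).1 (norm_sq_single i _)
  -- By convexity of the `S j` the segment between the two splices stays feasible, where the
  -- Lipschitz bound applies.
  have key := sub_le_of_gradient_lipschitz_segment P.differentiable_f
    (x := splice (i : ℕ) a b) (d := D) (q := Lmod i * ‖a i - b i‖ ^ 2) fun t ht => by
      have hmem : ∀ j, (splice (i : ℕ) a b + t • D) j ∈ P.S j := by
        intro j
        have h1 := splice_mem ha hb ((i : ℕ) + 1) j
        rw [splice_succ, ← hD] at h1
        have := (hconv j).add_smul_sub_mem (splice_mem ha hb (i : ℕ) j) h1 ht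
        simpa using this
      have hL := (hLip i).2 _ (fun j => mem_Sbar_of_mem_S hε (hmem j)) _
        (fun j => mem_Sbar_of_mem_S hε (splice_mem ha hb (i : ℕ) j))
      rw [add_sub_cancel_left, norm_smul, Real.norm_of_nonneg ht.1, hDn] at hL
      rw [hin]
      calc _ ≤ ‖P.blockGrad i (splice (i : ℕ) a b + t • D) - P.blockGrad i (splice (i : ℕ) a b)‖
              * ‖a i - b i‖ := real_inner_le_norm _ _
        _ ≤ (Lmod i * (t * ‖a i - b i‖)) * ‖a i - b i‖ := by gcongr
        _ = _ := by ring
  rw [hin] at key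
  exact key

theorem f_sub_eq_sum_splice (a b : P.Space) :
    P.f a - P.f b
      = ∑ i : Fin n, (P.f (splice ((i : ℕ) + 1) a b) - P.f (splice (i : ℕ) a b)) := by
  rw [Fin.sum_univ_eq_sum_range (fun m => P.f (splice (m + 1) a b) - P.f (splice m a b)) n,
    Finset.sum_range_sub (fun m => P.f (splice m a b)), splice_full, splice_zero]

/-- With `ν = 12 / (γ - 1)` the term `n / (γ - 1)` is `νn/12`, and the terms of `C1` linear in `ν`
already dominate it by a positive quadratic in `n`. -/
theorem le_C1 {L γ : ℝ} (hL : 0 ≤ L) (hγ : 1 < γ) (σ : ℕ → Fin n → ℝ) (k : ℕ) :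
    (⨆ i, σ k i) / 2 + L * (n / (γ - 1)) ≤ C1 L γ σ k := by
  have hν : 0 < 12 / (γ - 1) := by
    have := sub_pos.2 hγ
    positivity
  have e : (n : ℝ) / (γ - 1) = 12 / (γ - 1) / 12 * n := by ring
  have hn : (0 : ℝ) ≤ (n : ℝ) * (3 * n - 4) + 24 / 12 := by
    rcases n with _ | _ | m
    · norm_num
    · norm_num
    · push_cast
      have : (0 : ℝ) ≤ m := m.cast_nonneg
      nlinarith [mul_nonneg this this]
  rw [e, C1]
  generalize 12 / (γ - 1) = ν at hν
  have h2 : 0 ≤ 2 / ν := by positivity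
  have h3 : 0 ≤ ν * ((n : ℝ) * (3 * n - 4) + 24 / 12) := by positivity
  have h4 : 0 ≤ 2 / ν * n := by positivity
  have h5 : (0 : ℝ) ≤ n := n.cast_nonneg
  have h6 : ν / 12 * n ≤ (ν / 2 * (n : ℝ) ^ 2 + (2 + 2 / ν - ν / 2) * n + 2 * ν + 4 / ν + 3) / 2 := by
    have e4 : 4 / ν = 2 * (2 / ν) := by ring
    rw [e4]
    nlinarith
  have := mul_le_mul_of_nonneg_left h6 hL
  linarith

/-- The decrease of `f` between consecutive exact iterates. -/
theorem f_exact_succ_add_le {Lmod : Fin n → ℝ} {L γ M εbar : ℝ} {ε : ℕ → ℝ}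
    {σ : ℕ → Fin n → ℝ} {z zbar : ℕ → P.Space} {k : ℕ} (hL : L = ⨆ i, Lmod i) (hγ : 1 < γ)
    (hε : 0 ≤ εbar) (hLip : P.BlockLipschitz εbar Lmod) (hconv : ∀ i, Convex ℝ (P.S i))
    (hz : P.IsIterates εbar (γ * L) M ε σ z) (hzbar : P.IsExactIterates σ z zbar)
    (hmem : ∀ k i, zbar k i ∈ P.S i) (hk : z k ∈ P.SbarProd εbar)
    (hk1 : z (k + 1) ∈ P.SbarProd εbar) :
    P.f (zbar (k + 1)) - P.f (zbar k) + L * (γ - 1) / 4 * ‖zbar (k + 1) - zbar k‖ ^ 2 ≤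
      ((⨆ i, σ k i) / 2 + L * (n / (γ - 1))) * ‖zbar k - z k‖ ^ 2
        + L * (n / (γ - 1)) * ‖zbar (k + 1) - z (k + 1)‖ ^ 2 := by
  have hγ' : 0 < γ - 1 := sub_pos.2 hγ
  set A := ‖zbar k - z k‖ ^ 2 with hA
  set B := ‖zbar (k + 1) - z (k + 1)‖ ^ 2
  have hblock : ∀ i : Fin n,
      P.f (splice ((i : ℕ) + 1) (zbar (k + 1)) (zbar k))
          - P.f (splice (i : ℕ) (zbar (k + 1)) (zbar k))
        ≤ (⨆ i, σ k i) / 2 * ‖(zbar k - z k) i‖ ^ 2 + L / (γ - 1) * (B + A)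
          - L * (γ - 1) / 4 * ‖(zbar (k + 1) - zbar k) i‖ ^ 2 := by
    intro i
    have hLi : Lmod i ≤ L := hL ▸ le_ciSup (Set.finite_range Lmod).bddAbove i
    have hL0 : 0 < L := (hLip i).1.trans_le hLi
    have hσ : σ k i ≤ ⨆ i, σ k i := le_ciSup (Set.finite_range (σ k)).bddAbove i
    have h1 := f_splice_succ_le hε hLip hconv (hmem (k + 1)) (hmem k) i
    have h2 := (hzbar.isMinOn k i).inner_prox_le (hconv i) (hmem (k + 1) i) (hmem k i)
    have h3 := (hLip i).2 _
      (splice_mem (fun j => mem_Sbar_of_mem_S hε (hmem (k + 1) j))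
        (fun j => mem_Sbar_of_mem_S hε (hmem k j)) (i : ℕ)) _
      (splice_mem (s := P.Sbar εbar) hk1 hk (i : ℕ))
    have hE := norm_splice_sub_splice_sq_le (i : ℕ) (zbar (k + 1)) (zbar k) (z (k + 1)) (z k)
    rw [stepGrad, mix_eq_splice] at h2
    simp only [PiLp.sub_apply]
    set E := ‖splice (i : ℕ) (zbar (k + 1)) (zbar k) - splice (i : ℕ) (z (k + 1)) (z k)‖
    set g := P.blockGrad i (splice (i : ℕ) (z (k + 1)) (z k))
    set g' := P.blockGrad i (splice (i : ℕ) (zbar (k + 1)) (zbar k))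
    set d := zbar (k + 1) i - zbar k i
    have h4 : inner ℝ g' d = inner ℝ g d + inner ℝ (g' - g) d := by
      rw [inner_sub_left]; ring
    have h5 : inner ℝ (g' - g) d ≤ L * (E * ‖d‖) := by
      calc inner ℝ (g' - g) d ≤ ‖g' - g‖ * ‖d‖ := real_inner_le_norm _ _
        _ ≤ (L * E) * ‖d‖ := by
            gcongr
            exact h3.trans (by gcongr)
        _ = _ := by ring
    -- Young's inequality with the weight that spends half of the gain `L(γ-1)/2 ‖d‖²` left by `σ ≥
    -- γL` over the descent term. The bound `E² ≤ B + A` is the same for every block, so summation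
    -- produces the factor `n`.
    have h6 : E * ‖d‖ ≤ 1 / (γ - 1) * (B + A) + (γ - 1) / 4 * ‖d‖ ^ 2 := by
      have e1 : E * ‖d‖ ≤ 1 / (γ - 1) * E ^ 2 + (γ - 1) / 4 * ‖d‖ ^ 2 := by
        have : 1 / (γ - 1) * E ^ 2 + (γ - 1) / 4 * ‖d‖ ^ 2 - E * ‖d‖
            = (E - (γ - 1) / 2 * ‖d‖) ^ 2 / (γ - 1) := by
          field_simp
          ring
        have h0 : 0 ≤ (E - (γ - 1) / 2 * ‖d‖) ^ 2 / (γ - 1) := by positivity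
        linarith
      have e2 : 1 / (γ - 1) * E ^ 2 ≤ 1 / (γ - 1) * (B + A) := by gcongr
      linarith
    have h7 := mul_le_mul_of_nonneg_left h6 hL0.le
    have h8 : γ * L * ‖d‖ ^ 2 ≤ σ k i * ‖d‖ ^ 2 := by
      gcongr
      exact (hz.prox_mem k i).1
    have h9 : Lmod i * ‖d‖ ^ 2 ≤ L * ‖d‖ ^ 2 := by gcongr
    have h10 : σ k i * ‖zbar k i - z k i‖ ^ 2 ≤ (⨆ i, σ k i) * ‖zbar k i - z k i‖ ^ 2 := by gcongr
    have h11 : 0 ≤ σ k i * ‖zbar (k + 1) i - z k i‖ ^ 2 := by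
      have : 0 ≤ σ k i := le_trans (by positivity) (hz.prox_mem k i).1
      positivity
    have e : L * (1 / (γ - 1) * (B + A)) = L / (γ - 1) * (B + A) := by ring
    linarith
  have hsum := Finset.sum_le_sum fun i (_ : i ∈ Finset.univ) => hblock i
  rw [← f_sub_eq_sum_splice, Finset.sum_sub_distrib, Finset.sum_add_distrib, ← Finset.mul_sum (a := L * (γ - 1) / 4),
    ← Finset.mul_sum (a := (⨆ i, σ k i) / 2), ← norm_sq_eq_sum, ← norm_sq_eq_sum, Finset.sum_const, Finset.card_univ,
    Fintype.card_fin, nsmul_eq_mul, ← hA] at hsum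
  have e : (n : ℝ) * (L / (γ - 1) * (B + A)) = L * (n / (γ - 1)) * (B + A) := by ring
  rw [e] at hsum
  linarith

/-! ### Distance between inexact and exact iterates -/

theorem differentiable_h_apply (i : Fin n) (j : Fin (P.p i)) :
    Differentiable ℝ (fun x => P.h i x j) :=
  fun x => (differentiableAt_euclidean.1 (P.differentiable_h i x)) j

/-- A point with small residual is close to the exact projection `p` of `xt` onto the feasible
set. -/
theorem sq_norm_sub_le_of_residual {i : Fin n} {x xt p : P.Block i} {lam : Fin (P.p i) → ℝ}
    {τ c R T : ℝ} (hlam : ∀ j, 0 ≤ lam j) (hr : P.residual i x lam xt ≤ τ) (hp : p ∈ P.S i)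
    (hcomp : IsCompact (P.S i)) (hc : 0 ≤ c)
    (hbound : Metric.infDist x (P.S i) ≤
      c * ‖(WithLp.toLp 2 (fun j => max (P.h i x j) 0) : EuclideanSpace ℝ (Fin (P.p i)))‖)
    (hR : ‖p‖ ≤ R) (hT : ‖p - xt‖ ≤ T) (hvi : ∀ y ∈ P.S i, 0 ≤ inner ℝ (p - xt) (y - p)) :
    ‖x - p‖ ^ 2 ≤ (√(P.m i) * R + 2 + T * (c * √(P.p i))) * τ := by
  set s := P.dualResidual i x lam xt with hs
  have r1 : 0 ≤ max (inner ℝ x s) 0 := le_max_right _ _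
  have r2 : 0 ≤ ‖(WithLp.ofLp s : Fin (P.m i) → ℝ)‖ := norm_nonneg _
  have r3 : 0 ≤ ‖(fun j => max (P.h i x j) 0 : Fin (P.p i) → ℝ)‖ := norm_nonneg _
  have r4 : 0 ≤ max (-∑ j, lam j * P.h i x j) 0 := le_max_right _ _
  have hr' : max (inner ℝ x s) 0 + ‖(WithLp.ofLp s : Fin (P.m i) → ℝ)‖
      + ‖(fun j => max (P.h i x j) 0 : Fin (P.p i) → ℝ)‖
      + max (-∑ j, lam j * P.h i x j) 0 ≤ τ := hr
  have hτ : 0 ≤ τ := by linarith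
  have q1 : inner ℝ x s ≤ τ := (le_max_left _ _).trans (by linarith)
  have q4 : -∑ j, lam j * P.h i x j ≤ τ := (le_max_left _ _).trans (by linarith)
  have q2 : ‖s‖ ≤ √(P.m i) * τ := (EuclideanSpace.norm_le_sqrt_mul_norm_ofLp s).trans <| by
    gcongr
    linarith
  have q3 : ‖(WithLp.toLp 2 (fun j => max (P.h i x j) 0) : EuclideanSpace ℝ (Fin (P.p i)))‖
      ≤ √(P.p i) * τ := (EuclideanSpace.norm_le_sqrt_mul_norm_ofLp _).trans <| by
    gcongr
    linarith
  obtain ⟨y, hy, hdist⟩ := hcomp.exists_infDist_eq_dist ⟨p, hp⟩ x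
  have hyx : ‖y - x‖ ≤ c * (√(P.p i) * τ) := by
    rw [← dist_eq_norm, dist_comm, ← hdist]
    exact hbound.trans (by gcongr)
  have hR0 : 0 ≤ R := (norm_nonneg _).trans hR
  have hsp : -(√(P.m i) * τ * R) ≤ inner ℝ s p := by
    have h1 := (abs_le.1 (abs_real_inner_le_norm s p)).1
    have h2 : ‖s‖ * ‖p‖ ≤ √(P.m i) * τ * R := by gcongr
    linarith
  -- Tangent inequality for each `h_j`, together with `h_j(p) ≤ 0` and `lam j ≥ 0`.
  have hgrad : ∑ j, lam j * inner ℝ (gradient (fun y => P.h i y j) x) (p - x)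
      ≤ -∑ j, lam j * P.h i x j := by
    rw [← Finset.sum_neg_distrib]
    refine Finset.sum_le_sum fun j _ => ?_
    have h1 := (P.convex_h i j).add_inner_gradient_le (differentiable_h_apply i j x) p
    have h2 := hp j
    rw [← mul_neg]
    exact mul_le_mul_of_nonneg_left (by linarith) (hlam j)
  -- The 2 counts one `τ` from `⟨x, s⟩` and one from the complementarity term.
  have hlow : -((√(P.m i) * R + 2) * τ) ≤ inner ℝ (x - xt) (p - x) := by
    have e : x - xt = s - ∑ j, lam j • gradient (fun y => P.h i y j) x := by
      rw [hs, dualResidual]; abel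
    rw [e, inner_sub_left, sum_inner, inner_sub_right, real_inner_comm x s]
    simp only [real_inner_smul_left]
    linarith
  refine (sq_norm_sub_le_of_approx_projection hlow (hvi y hy) hyx).trans ?_
  have : ‖p - xt‖ * (c * (√(P.p i) * τ)) ≤ T * (c * (√(P.p i) * τ)) := by gcongr
  linarith

theorem exists_norm_le_of_mem_Sbar {εbar : ℝ} {i : Fin n} (hcomp : IsCompact (P.S i))
    (hne : (P.S i).Nonempty) : ∃ R, ∀ w ∈ P.Sbar εbar i, ‖w‖ ≤ R := by
  obtain ⟨R, hR⟩ := hcomp.isBounded.exists_norm_le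
  refine ⟨R + εbar, fun w hw => ?_⟩
  obtain ⟨y, hy, hdist⟩ := hcomp.exists_infDist_eq_dist hne w
  have h1 : ‖w - y‖ ≤ εbar := by
    rw [← dist_eq_norm, ← hdist]
    exact hw
  have h2 := norm_le_norm_add_norm_sub' w y
  have h3 := hR y hy
  linarith

/-- The gradient at one feasible point, plus the Lipschitz modulus times a bound on the diameter of
the enlarged product. -/
theorem exists_norm_blockGrad_le {εbar : ℝ} {Lmod : Fin n → ℝ} (hε : 0 ≤ εbar)
    (hLip : P.BlockLipschitz εbar Lmod) (hcomp : ∀ i, IsCompact (P.S i))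
    (hne : ∀ i, (P.S i).Nonempty) (i : Fin n) :
    ∃ G, ∀ x ∈ P.SbarProd εbar, ‖P.blockGrad i x‖ ≤ G := by
  choose R hR using fun i => exists_norm_le_of_mem_Sbar (εbar := εbar) (hcomp i) (hne i)
  choose y hy using hne
  set x₀ : P.Space := WithLp.toLp 2 y
  have hx₀ : x₀ ∈ P.SbarProd εbar := fun j => mem_Sbar_of_mem_S hε (hy j)
  have hnorm : ∀ x ∈ P.SbarProd εbar, ‖x‖ ≤ √(∑ j, R j ^ 2) := by
    intro x hx
    refine Real.le_sqrt_of_sq_le ?_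
    rw [norm_sq_eq_sum]
    gcongr with j
    exact hR j _ (hx j)
  refine ⟨‖P.blockGrad i x₀‖ + Lmod i * (√(∑ j, R j ^ 2) + √(∑ j, R j ^ 2)), fun x hx => ?_⟩
  have h1 := (hLip i).2 x hx x₀ hx₀
  have h2 : ‖x - x₀‖ ≤ √(∑ j, R j ^ 2) + √(∑ j, R j ^ 2) :=
    (norm_sub_le _ _).trans (add_le_add (hnorm x hx) (hnorm x₀ hx₀))
  have h3 := mul_le_mul_of_nonneg_left h2 (hLip i).1.le
  have h4 := norm_le_norm_add_norm_sub' (P.blockGrad i x) (P.blockGrad i x₀)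
  linarith

/-- The distance between an inexact and an exact iterate is of the order of the tolerance. -/
theorem exists_norm_sq_block_sub_le {Lmod : Fin n → ℝ} {L γ M εbar : ℝ} {ε : ℕ → ℝ}
    {σ : ℕ → Fin n → ℝ} {z zbar : ℕ → P.Space} {K : ℕ} (hL : 0 < γ * L) (hε : 0 ≤ εbar)
    (hLip : P.BlockLipschitz εbar Lmod) (hS : P.ConstraintAssumption εbar (γ * L))
    (hz : P.IsIterates εbar (γ * L) M ε σ z) (hzbar : P.IsExactIterates σ z zbar)
    (hK : ∀ k ≥ K, z k ∈ P.SbarProd εbar) (i : Fin n) :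
    ∃ C : ℝ, ∀ k ≥ K, ‖z (k + 1) i - zbar (k + 1) i‖ ^ 2 ≤ C * ε k ^ 2 := by
  have hne : ∀ i, (P.S i).Nonempty := fun i => ⟨_, hzbar.init_mem i⟩
  obtain ⟨hconv, hcomp, -, c, hc, hHoff⟩ := hS i
  obtain ⟨R, hR⟩ := exists_norm_le_of_mem_Sbar (εbar := εbar) hcomp (hne i)
  obtain ⟨G, hG⟩ := exists_norm_blockGrad_le hε hLip (fun i => (hS i).2.1) hne i
  -- Here `R` bounds the enlarged block set and `R + G/(γL)` bounds `x̃`; the residual is at most `ε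
  -- k ^ 2`.
  refine ⟨√(P.m i) * R + 2 + (R + (R + 1 / (γ * L) * G)) * (c * √(P.p i)), fun k hk => ?_⟩
  obtain ⟨lam, hlam, hres⟩ := hz.inexact k i
  have hk0 := hK k hk
  have hk1 := hK (k + 1) (hk.le.trans k.le_succ)
  have hp := hzbar.mem k i
  have hpR : ‖zbar (k + 1) i‖ ≤ R := hR _ (mem_Sbar_of_mem_S hε hp)
  have hσ : γ * L ≤ σ k i := (hz.prox_mem k i).1
  have hσ0 : 0 < σ k i := hL.trans_le hσ
  have hg : ‖P.stepGrad z k i‖ ≤ G := by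
    rw [stepGrad, mix_eq_splice]
    exact hG _ (splice_mem (s := P.Sbar εbar) hk1 hk0 _)
  have hxt : ‖P.xtilde σ z k i‖ ≤ R + 1 / (γ * L) * G := by
    refine (norm_sub_le _ _).trans (add_le_add (hR _ (hk0 i)) ?_)
    rw [norm_smul, Real.norm_of_nonneg (by positivity)]
    gcongr
  have hx : z (k + 1) i ∈ P.Stilde εbar (γ * L) i := by
    simp only [Stilde, Set.mem_ofPred_eq, Metric.infDist_zero_of_mem (hk1 i)]
    refine div_nonneg (Real.sSup_nonneg ?_) hL.le
    rintro _ ⟨x, -, rfl⟩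
    exact norm_nonneg _
  refine sq_norm_sub_le_of_residual hlam ((Real.sqrt_le_iff.1 hres).2) hp hcomp hc (hHoff _ hx)
    hpR ((norm_sub_le _ _).trans (add_le_add hpR hxt)) fun y hy => ?_
  have h := (hzbar.isMinOn k i).inner_prox_nonneg hconv hp hy
  -- Dividing by `σ k i` turns optimality for the subproblem into the variational inequality of the
  -- projection of `x̃`.
  have e : P.stepGrad z k i + σ k i • (zbar (k + 1) i - z k i)
      = σ k i • (zbar (k + 1) i - P.xtilde σ z k i) := by
    rw [xtilde, smul_sub, smul_sub, smul_sub, smul_smul, mul_one_div_cancel hσ0.ne', one_smul]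
    abel
  rw [e, real_inner_smul_left] at h
  exact nonneg_of_mul_nonneg_right h hσ0

/-- The distance between inexact and exact iterates is of the order of the tolerance. -/
theorem exists_norm_sub_le {Lmod : Fin n → ℝ} {L γ M εbar : ℝ} {ε : ℕ → ℝ}
    {σ : ℕ → Fin n → ℝ} {z zbar : ℕ → P.Space} {K : ℕ} (hL : L = ⨆ i, Lmod i) (hγ : 1 < γ)
    (hε : 0 ≤ εbar)
    (hLip : P.BlockLipschitz εbar Lmod) (hS : P.ConstraintAssumption εbar (γ * L))
    (hz : P.IsIterates εbar (γ * L) M ε σ z) (hzbar : P.IsExactIterates σ z zbar)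
    (hK : ∀ k ≥ K, z k ∈ P.SbarProd εbar) :
    ∃ D : ℝ, 0 ≤ D ∧ ∀ k ≥ K, ‖z (k + 1) - zbar (k + 1)‖ ≤ D * ε k := by
  -- For `n = 0` the supremum `L` is `0`, so positivity needs a block.
  have hpos : ∀ i : Fin n, 0 < γ * L := fun i =>
    mul_pos (by linarith)
      ((hLip i).1.trans_le (hL ▸ le_ciSup (Set.finite_range Lmod).bddAbove i))
  choose C hC using fun i => exists_norm_sq_block_sub_le (hpos i) hε hLip hS hz hzbar hK i
  refine ⟨√|∑ i, C i|, Real.sqrt_nonneg _, fun k hk => ?_⟩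
  have hεk := hz.tol_nonneg k
  rw [← sq_le_sq₀ (norm_nonneg _) (by positivity), mul_pow, Real.sq_sqrt (abs_nonneg _),
    norm_sq_eq_sum]
  calc _ ≤ ∑ i, C i * ε k ^ 2 := Finset.sum_le_sum fun i _ => hC i k hk
    _ = (∑ i, C i) * ε k ^ 2 := (Finset.sum_mul ..).symm
    _ ≤ _ := by
      gcongr
      exact le_abs_self _

/-! ### Error tails and compactness -/

theorem C1_nonneg {L γ M εbar : ℝ} {ε : ℕ → ℝ} {σ : ℕ → Fin n → ℝ} {z : ℕ → P.Space}
    (hL : 0 ≤ L) (hγ : 1 < γ) (hz : P.IsIterates εbar (γ * L) M ε σ z) (k : ℕ) :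
    0 ≤ (⨆ i, σ k i) ∧ 0 ≤ C1 L γ σ k := by
  have h1 : 0 ≤ ⨆ i, σ k i :=
    Real.iSup_nonneg fun i => le_trans (by positivity) (hz.prox_mem k i).1
  have h2 := le_C1 hL hγ σ k
  have h3 : 0 ≤ L * (n / (γ - 1)) := by
    have := sub_pos.2 hγ
    positivity
  exact ⟨h1, by linarith⟩

/-- `C1` is bounded because `σ ≤ M`, and `ε_k² ≤ ε̄ ε_k` makes the squared errors summable. -/
theorem summable_errTerm {L γ M εbar D : ℝ} {ε : ℕ → ℝ} {σ : ℕ → Fin n → ℝ}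
    {z zbar : ℕ → P.Space} {K : ℕ} (hL : 0 ≤ L) (hγ : 1 < γ) (hM : γ * L ≤ M)
    (hz : P.IsIterates εbar (γ * L) M ε σ z) (hε : Summable ε)
    (hD : ∀ k ≥ K, ‖z (k + 1) - zbar (k + 1)‖ ≤ D * ε k) :
    Summable (P.errTerm L γ σ z zbar) := by
  obtain ⟨Q, hQ⟩ : ∃ Q, ∀ k, C1 L γ σ k ≤ Q := by
    let ν := 12 / (γ - 1)
    refine ⟨(M + L * (ν / 2 * (n : ℝ) ^ 2 + (2 + 2 / ν - ν / 2) * (n : ℝ)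
      + 2 * ν + 4 / ν + 3)) / 2, fun k => ?_⟩
    rw [C1]
    have : (⨆ i, σ k i) ≤ M :=
      Real.iSup_le (fun i => (hz.prox_mem k i).2) (le_trans (by positivity) hM)
    gcongr
  have hε2 : Summable fun k => ε k ^ 2 := by
    refine Summable.of_nonneg_of_le (fun k => sq_nonneg _) (fun k => ?_) (hε.mul_left εbar)
    rw [sq]
    exact mul_le_mul_of_nonneg_right (hz.tol_le k) (hz.tol_nonneg k)
  rw [← summable_nat_add_iff (K + 1)]
  refine Summable.of_nonneg_of_le (fun k => ?_) (fun k => ?_)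
    (((summable_nat_add_iff K).2 hε2).mul_left (Q * D ^ 2))
  · exact mul_nonneg (C1_nonneg hL hγ hz _).2 (sq_nonneg _)
  · have h1 := hD (k + K) (Nat.le_add_left _ _)
    have h2 : ‖zbar (k + (K + 1)) - z (k + (K + 1))‖ ^ 2 ≤ (D * ε (k + K)) ^ 2 := by
      rw [norm_sub_rev]
      exact pow_le_pow_left₀ (norm_nonneg _) h1 2
    calc _ ≤ Q * (D * ε (k + K)) ^ 2 :=
          mul_le_mul (hQ _) h2 (sq_nonneg _) ((C1_nonneg hL hγ hz 0).2.trans (hQ 0))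
      _ = _ := by ring

theorem errTail_eq_add {L γ : ℝ} {σ : ℕ → Fin n → ℝ} {z zbar : ℕ → P.Space}
    (hs : Summable (P.errTerm L γ σ z zbar)) (k : ℕ) :
    P.errTail L γ σ z zbar k = P.errTerm L γ σ z zbar k + P.errTail L γ σ z zbar (k + 1) := by
  have hs' : Summable fun t => P.errTerm L γ σ z zbar (k + t) := by
    simpa only [add_comm k] using (summable_nat_add_iff k).2 hs
  rw [errTail, hs'.tsum_eq_zero_add, errTail]
  simp only [add_zero, add_assoc, add_comm 1]

theorem isCompact_feasible (hcomp : ∀ i, IsCompact (P.S i)) :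
    IsCompact {x : P.Space | ∀ i, x i ∈ P.S i} := by
  convert (isCompact_univ_pi hcomp).image (PiLp.continuous_toLp 2 _) using 1
  ext x
  constructor
  · exact fun hx => ⟨WithLp.ofLp x, fun i _ => hx i, rfl⟩
  · rintro ⟨y, hy, rfl⟩ i
    exact hy i trivial

end BlockProblem

/-! ### Convergence of the surrogate and rates -/

open BlockProblem in
theorem mainTheorem8 {n : ℕ} (P : BlockProblem n)
    (Lmod : Fin n → ℝ) (L γ M εbar : ℝ)
    (ε : ℕ → ℝ) (σ : ℕ → Fin n → ℝ) (z zbar : ℕ → P.Space) (K : ℕ)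
    (hL : L = ⨆ i, Lmod i) (hγ : 1 < γ) (hM : γ * L ≤ M) (hεbar : 0 < εbar)
    (hLip : P.BlockLipschitz εbar Lmod)
    (hS : P.ConstraintAssumption εbar (γ * L))
    (hKL : ∀ x : P.Space, IsStationaryPt P.F x → HasLojasiewicz P.F x)
    (hε : ToleranceCondition ε)
    (hz : P.IsIterates εbar (γ * L) M ε σ z)
    (hzbar : P.IsExactIterates σ z zbar)
    (hK : ∀ k ≥ K, z k ∈ P.SbarProd εbar) :
    Summable (P.errTerm L γ σ z zbar) ∧
    ∃ Fbar : ℝ, Tendsto (P.surrogate L γ σ z zbar) atTop (𝓝 Fbar) ∧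
      (P.surrogate L γ σ z zbar K = Fbar →
        ∃ zlim : P.Space, Tendsto z atTop (𝓝 zlim) ∧
          (∀ ρ : ℝ, 0 < ρ → ρ < 1 → (∀ k : ℕ, ε k = εbar * ρ ^ k) →
            ∃ C : ℝ, ∀ k ≥ K, ‖z k - zlim‖ ≤ C * ρ ^ k) ∧
          (∀ ℓ : ℝ, 1 < ℓ → (∀ k : ℕ, ε k = εbar / ((k : ℝ) + 1) ^ ℓ) →
            ∃ C : ℝ, ∀ k ≥ K, 1 ≤ k → ‖z k - zlim‖ ≤ C * (k : ℝ) ^ (-(ℓ - 1)))) := by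
  have hγ' : 0 < γ - 1 := sub_pos.2 hγ
  have hL0 : 0 ≤ L := hL ▸ Real.iSup_nonneg fun i => (hLip i).1.le
  have hmem : ∀ k i, zbar k i ∈ P.S i
    | 0, i => hzbar.init_mem i
    | k + 1, i => hzbar.mem k i
  obtain ⟨D, hD0, hD⟩ := exists_norm_sub_le hL hγ hεbar.le hLip hS hz hzbar hK
  have hsum := summable_errTerm hL0 hγ hM hz hε.2.1 hD
  -- Passing from `k` to `k + 1` removes exactly the error terms `k` and `k + 1` from `u^(k) +
  -- u^(k+1)`.
  have hdec : ∀ k ≥ K, P.surrogate L γ σ z zbar (k + 1)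
      + L * (γ - 1) / 4 * ‖zbar (k + 1) - zbar k‖ ^ 2 ≤ P.surrogate L γ σ z zbar k := by
    intro k hk
    have h1 := f_exact_succ_add_le hL hγ hεbar.le hLip (fun i => (hS i).1) hz hzbar hmem
      (hK k hk) (hK (k + 1) (hk.le.trans k.le_succ))
    have h2 := mul_le_mul_of_nonneg_right (le_C1 hL0 hγ σ k) (sq_nonneg ‖zbar k - z k‖)
    have h3 : L * (n / (γ - 1)) * ‖zbar (k + 1) - z (k + 1)‖ ^ 2
        ≤ C1 L γ σ (k + 1) * ‖zbar (k + 1) - z (k + 1)‖ ^ 2 := by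
      have h4 := le_C1 hL0 hγ σ (k + 1)
      have h5 := (C1_nonneg hL0 hγ hz (k + 1)).1
      exact mul_le_mul_of_nonneg_right (by linarith) (sq_nonneg _)
    have h6 := errTail_eq_add hsum k
    have h7 := errTail_eq_add hsum (k + 1)
    simp only [errTerm] at h6 h7
    simp only [surrogate, toReal_F_of_mem (hmem _)]
    linarith
  have hanti : Antitone fun k => P.surrogate L γ σ z zbar (k + K) := by
    refine antitone_nat_of_succ_le fun k => ?_
    have h1 := hdec (k + K) (Nat.le_add_left _ _)
    have h2 : 0 ≤ L * (γ - 1) / 4 * ‖zbar (k + K + 1) - zbar (k + K)‖ ^ 2 := by positivity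
    rw [add_right_comm]
    linarith
  have hbdd : BddBelow (Set.range fun k => P.surrogate L γ σ z zbar (k + K)) := by
    obtain ⟨b, hb⟩ := (isCompact_feasible fun i => (hS i).2.1).bddBelow_image
      P.differentiable_f.continuous.continuousOn
    refine ⟨b, ?_⟩
    rintro _ ⟨k, rfl⟩
    have h1 : b ≤ P.f (zbar (k + K)) := hb ⟨_, hmem (k + K), rfl⟩
    have h2 : ∀ m, 0 ≤ P.errTail L γ σ z zbar m := fun m =>
      tsum_nonneg fun t => mul_nonneg (C1_nonneg hL0 hγ hz _).2 (sq_nonneg _)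
    simp only [surrogate, toReal_F_of_mem (hmem _)]
    linarith [h2 (k + K), h2 (k + K + 1)]
  have hlim := tendsto_atTop_ciInf hanti hbdd
  refine ⟨hsum, _, (tendsto_add_atTop_iff_nat K).1 hlim, fun hKF => ?_⟩
  -- A decreasing sequence that starts at its limit is constant.
  have hconst : ∀ k ≥ K, P.surrogate L γ σ z zbar k = P.surrogate L γ σ z zbar K := by
    intro k hk
    obtain ⟨m, rfl⟩ := Nat.exists_eq_add_of_le' hk
    have h1 := hanti.le_of_tendsto hlim m
    have h2 := hanti (Nat.zero_le m)
    simp only [zero_add] at h2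
    exact le_antisymm h2 (hKF.le.trans h1)
  have hzb : ∀ k ≥ K, zbar k = zbar K := by
    refine Nat.le_induction rfl fun k hk ih => ?_
    rw [← ih]
    ext1 i
    have hLpos : 0 < L :=
      (hLip i).1.trans_le (hL ▸ le_ciSup (Set.finite_range Lmod).bddAbove i)
    have h1 := hdec k hk
    rw [hconst k hk, hconst (k + 1) (hk.trans k.le_succ)] at h1
    have h2 : ‖zbar (k + 1) - zbar k‖ ^ 2 ≤ 0 :=
      nonpos_of_mul_nonpos_right (by linarith) (by positivity : 0 < L * (γ - 1) / 4)
    have h3 : zbar (k + 1) - zbar k = 0 := by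
      simpa using le_antisymm h2 (sq_nonneg _)
    rw [sub_eq_zero.1 h3]
  have hrate : ∀ k ≥ K, ‖z (k + 1) - zbar K‖ ≤ D * ε k := by
    intro k hk
    rw [← hzb (k + 1) (hk.le.trans k.le_succ)]
    exact hD k hk
  refine ⟨zbar K, ?_, fun ρ hρ0 _ hρ => ?_, fun ℓ hℓ hεℓ => ?_⟩
  · rw [← tendsto_add_atTop_iff_nat 1, tendsto_iff_norm_sub_tendsto_zero]
    have h0 : Tendsto (fun k => D * ε k) atTop (𝓝 0) := by
      simpa using hε.2.1.tendsto_atTop_zero.const_mul D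
    refine squeeze_zero' (Eventually.of_forall fun k => norm_nonneg _) ?_ h0
    filter_upwards [eventually_ge_atTop K] with k hk using hrate k hk
  · refine exists_forall_ge_le_mul_of_succ (A := D * εbar / ρ) (by positivity)
      (fun k => by positivity) fun k hk => (hrate k hk).trans (le_of_eq ?_)
    rw [hρ, pow_succ]
    field_simp
  -- The start is `max K 1` because `0 ^ (-(ℓ - 1))` evaluates to `0`. The bound of order
  -- `(k+1)^(-ℓ)` is weakened to exponent `-(ℓ - 1)`.
  · obtain ⟨C, hC⟩ := exists_forall_ge_le_mul_of_succ (a := fun k => ‖z k - zbar K‖)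
      (b := fun k => (k : ℝ) ^ (-(ℓ - 1))) (K := max K 1) (A := D * εbar)
      (Real.rpow_pos_of_pos (by exact_mod_cast lt_max_of_lt_right one_pos) _)
      (fun k => by positivity) fun k hk => by
        refine (hrate k ((le_max_left _ _).trans hk)).trans ?_
        rw [hεℓ, mul_assoc, div_eq_mul_inv, ← Real.rpow_neg (by positivity), Nat.cast_succ]
        gcongr
        · linarith [(k.cast_nonneg : (0 : ℝ) ≤ k)]
        · linarith
    exact ⟨C, fun k hk hk1 => hC k (max_le hk hk1)⟩

end
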